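/- Let $\mu,\kappa,\alpha,\beta,\gamma,\tau,\lambda,\nu$ be real constants with $\mu>0$, $\kappa>0$, $\tilde\alpha:=\alpha+\tfrac{4\beta}{3}>0$, $\tilde\gamma:=\beta+\gamma>0$, $\tau>0$ and $\lambda>\nu>0$. Put $J_{eq}=\operatorname{diag}(\lambda,\lambda,\nu)$ and $s=-\frac{1}{\sqrt{\lambda-\nu}}\frac{\tau}{2\kappa}$. For $k\in\mathbb{R}^3$ with Euclidean norm $|k|$ let $P_\parallel(k)=\frac{k\otimes k}{|k|^2}$ if $k\ne0$, $P_\parallel(0)=0$, $P_\perp(k)=I-P_\parallel(k)$, let $k\times$ denote the matrix of $z\mapsto k\times z$, and let $T(k)=\frac{i\,k\times}{|k|}$ if $k\neq 0$, $T(0)=0$. Let $$R_{22}=\begin{pmatrix}0&-1\\1&0\end{pmatrix},\quad R_{23}=\begin{pmatrix}0&-1&0\\1&0&0\end{pmatrix},\quad R_{32}=\begin{pmatrix}0&-1\\1&0\\0&0\end{pmatrix},\quad R_{33}=\begin{pmatrix}0&-1&0\\1&0&0\\0&0&0\end{pmatrix}.$$ Define the $8\times 8$ matrices (in blocks of sizes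 $3,3,2$) $$\hat{\mathcal B}_k=\begin{pmatrix}-(\mu+\frac\kappa2)|k|^2P_\perp(k)& i\kappa\, k\times&0\\ J_{eq}^{-1}(i\kappa\, k\times)P_\perp(k)&-2\kappa J_{eq}^{-1}-\tilde\alpha|k|^2J_{eq}^{-1}P_\parallel(k)-\tilde\gamma|k|^2J_{eq}^{-1}P_\perp(k)-(1-\frac\nu\lambda)\frac{\tau}{2\kappa}R_{33}&-\frac1\lambda\left(\frac{\tau}{2\kappa}\right)^2R_{32}\\0&(\lambda-\nu)R_{23}&\frac{\tau}{2\kappa}R_{22}\end{pmatrix},$$ $$Q_k=T(k)\oplus J_{eq}^{1/2}\oplus sR_{22},\qquad \bar Q_k=T(k)\oplus J_{eq}^{-1/2}\oplus(-s^{-1})R_{22},\qquad M(k)=Q_k\,\hat{\mathcal B}_k\,\bar Q_k .$$ ($\hat{\mathcal B}_k$ is the Fourier symbol, on the torus, of the nontrivial block of the linearized equations of an anisotropic micropolar fluid about the equilibrium with angular velocity $\frac{\tau}{2\kappa}e_3$ and microinertia $J_{eq}$.) Then there exist $k_*\in\mathbb{Z}^3$ and $w_*\in\mathbb{C}$ with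 $\operatorname{Re}w_*>0$ such that 1. $w_*$ is an eigenvalue of $M(k_*)$, and 2. for every $k\in\mathbb{Z}^3$ and every (complex) eigenvalue $w$ of $M(k)$, $\operatorname{Re}w\le\operatorname{Re}w_*$. The maximal growth rate is then defined as $\eta_*:=\operatorname{Re}w_*$. -/

import Mathlib

namespace Micropolar

noncomputable section

/-- The physical constants: viscosities `μ, κ, α, β, γ`, magnitude `τ` of the microtorque, and the
eigenvalues `lam, lam, ν` of the microinertia. -/
structure Params where
  μ : ℝ
  κ : ℝ
  α : ℝ
  β : ℝ
  γ : ℝ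
  τ : ℝ
  lam : ℝ
  ν : ℝ

/-- The constants of an inertially oblong micropolar fluid driven by a constant microtorque. -/
structure Params.Oblong (p : Params) : Prop where
  μ_pos : 0 < p.μ
  κ_pos : 0 < p.κ
  αt_pos : 0 < p.α + 4 * p.β / 3
  γt_pos : 0 < p.β + p.γ
  τ_pos : 0 < p.τ
  ν_pos : 0 < p.ν
  ν_lt_lam : p.ν < p.lam

/-- `α̃ = α + 4β/3`. -/
def Params.αt (p : Params) : ℝ := p.α + 4 * p.β / 3

/-- `γ̃ = β + γ`. -/
def Params.γt (p : Params) : ℝ := p.β + p.γ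

/-- `τ / (2κ)`. -/
def Params.d (p : Params) : ℝ := p.τ / (2 * p.κ)

/-- `J_eq ^ r` for `J_eq = diag (λ, λ, ν)` and a real exponent `r`. -/
def Params.JeqPow (p : Params) (r : ℝ) : Matrix (Fin 3) (Fin 3) ℝ :=
  Matrix.diagonal ![p.lam ^ r, p.lam ^ r, p.ν ^ r]

/-- `s = - (λ - ν)^{-1/2} τ / (2κ)`. -/
def Params.s (p : Params) : ℝ := -1 / Real.sqrt (p.lam - p.ν) * p.d

/-- Wavenumbers, with the Euclidean norm. -/
abbrev Wave : Type := EuclideanSpace ℝ (Fin 3)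

/-- Orthogonal projection onto the span of `k`: `k ⊗ k / |k|²`, and `0` when `k = 0`. -/
def Ppar (k : Wave) : Matrix (Fin 3) (Fin 3) ℝ :=
  Matrix.of fun i j => k i * k j / ‖k‖ ^ 2

/-- Orthogonal projection onto the orthogonal complement of the span of `k`. -/
def Pperp (k : Wave) : Matrix (Fin 3) (Fin 3) ℝ := 1 - Ppar k

/-- The matrix of the linear map `z ↦ k × z`. -/
def cross (k : Wave) : Matrix (Fin 3) (Fin 3) ℝ :=
  !![0, -k 2, k 1;
     k 2, 0, -k 0;
     -k 1, k 0, 0]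

def R22 : Matrix (Fin 2) (Fin 2) ℝ := !![0, -1; 1, 0]

def R23 : Matrix (Fin 2) (Fin 3) ℝ := !![0, -1, 0; 1, 0, 0]

def R32 : Matrix (Fin 3) (Fin 2) ℝ := !![0, -1; 1, 0; 0, 0]

def R33 : Matrix (Fin 3) (Fin 3) ℝ := !![0, -1, 0; 1, 0, 0; 0, 0, 0]

/-- The eight indices, grouped as `ℂ⁸ = ℂ³ × ℂ³ × ℂ²`. -/
abbrev Idx : Type := Fin 3 ⊕ (Fin 3 ⊕ Fin 2)

/-- A real matrix, read as a complex one. -/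
def toC {m n : Type} (A : Matrix m n ℝ) : Matrix m n ℂ := A.map Complex.ofReal

/-- The 8-by-8 matrix with the given rows of blocks. -/
def blocks (A₁₁ A₁₂ : Matrix (Fin 3) (Fin 3) ℂ) (A₁₃ : Matrix (Fin 3) (Fin 2) ℂ)
    (A₂₁ A₂₂ : Matrix (Fin 3) (Fin 3) ℂ) (A₂₃ : Matrix (Fin 3) (Fin 2) ℂ)
    (A₃₁ A₃₂ : Matrix (Fin 2) (Fin 3) ℂ) (A₃₃ : Matrix (Fin 2) (Fin 2) ℂ) :
    Matrix Idx Idx ℂ :=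
  Matrix.fromBlocks A₁₁ (Matrix.fromCols A₁₂ A₁₃) (Matrix.fromRows A₂₁ A₃₁)
    (Matrix.fromBlocks A₂₂ A₂₃ A₃₂ A₃₃)

/-- `A ⊕ B ⊕ C`. -/
def directSum (A B : Matrix (Fin 3) (Fin 3) ℂ) (C : Matrix (Fin 2) (Fin 2) ℂ) :
    Matrix Idx Idx ℂ :=
  blocks A 0 0 0 B 0 0 0 C

/-- The symbol at wavenumber `k` of the Leray-projected linearization about the equilibrium
`(u, ω, J) = (0, τ / (2κ) e₃, diag (λ, λ, ν))`, in the unknowns `(u, ω, a)` with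
`a = (J₁₃, J₂₃)`. -/
def Bhat (p : Params) (k : Wave) : Matrix Idx Idx ℂ :=
  blocks
    (toC (-((p.μ + p.κ / 2) * ‖k‖ ^ 2) • Pperp k))
    ((Complex.I * p.κ) • toC (cross k))
    0
    (toC (p.JeqPow (-1)) * ((Complex.I * p.κ) • toC (cross k)) * toC (Pperp k))
    (toC (-(2 * p.κ) • p.JeqPow (-1)
      - (p.αt * ‖k‖ ^ 2) • (p.JeqPow (-1) * Ppar k)
      - (p.γt * ‖k‖ ^ 2) • (p.JeqPow (-1) * Pperp k)
      - ((1 - p.ν / p.lam) * p.d) • R33))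
    (toC (-(1 / p.lam * p.d ^ 2) • R32))
    0
    (toC ((p.lam - p.ν) • R23))
    (toC (p.d • R22))

/-- `T(k) = i k× / |k|`, and `0` when `k = 0`. -/
def T (k : Wave) : Matrix (Fin 3) (Fin 3) ℂ := (Complex.I / (‖k‖ : ℂ)) • toC (cross k)

/-- `Q_k = T(k) ⊕ J_eq^{1/2} ⊕ s R₂₂`. -/
def Q (p : Params) (k : Wave) : Matrix Idx Idx ℂ :=
  directSum (T k) (toC (p.JeqPow (1 / 2))) (toC (p.s • R22))

/-- `Q̄_k = T(k) ⊕ J_eq^{-1/2} ⊕ (-s⁻¹) R₂₂`. -/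
def Qbar (p : Params) (k : Wave) : Matrix Idx Idx ℂ :=
  directSum (T k) (toC (p.JeqPow (-1 / 2))) (toC ((-p.s⁻¹) • R22))

/-- `M_k = Q_k B̂_k Q̄_k`. -/
def M (p : Params) (k : Wave) : Matrix Idx Idx ℂ := Q p k * Bhat p k * Qbar p k

/-- A point of `ℤ³`, as a wavenumber. -/
def latt (k : Fin 3 → ℤ) : Wave := WithLp.toLp 2 fun i => (k i : ℝ)

/-- `w` is an eigenvalue of the matrix `A`. -/
def IsEigenvalue (A : Matrix Idx Idx ℂ) (w : ℂ) : Prop :=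
  Module.End.HasEigenvalue (Matrix.toLin' A) w

end

end Micropolar

/-!
Conjugation by `Q_k` turns the symbol into a real matrix. Its coupling between velocity and rotation
is symmetric, and `s` is chosen so that the one between rotation and microinertia is symmetric too;
the remaining non-symmetric parts are skew, so they drop out of the quadratic form, which bounds
`Re w` for every eigenvalue `w`. Young's inequality absorbs the velocity coupling into the viscosity
and leaves a damping of the angular velocity of order `|k|²`. Weighed against this damping, the
coupling to the otherwise undamped microinertia allows only growth rates that vanish as `|k| → ∞`.
Hence only finitely many eigenvalues have real part above a given `ε > 0`, and a maximum is attained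
as soon as one eigenvalue lies in the open right half-plane. At `k = 0` the horizontal modes satisfy
a quadratic dispersion relation that has such a root.
-/

namespace Micropolar

open Matrix Filter
open scoped MatrixOrder

theorem exists_max_re_hasEigenvalue {ι V : Type*} [AddCommGroup V] [Module ℂ V]
    [FiniteDimensional ℂ V] (f : ι → Module.End ℂ V)
    (hdecay : ∀ ε > 0, ∀ᶠ k in cofinite, ∀ w, (f k).HasEigenvalue w → w.re ≤ ε)
    (hunstable : ∃ k w, 0 < w.re ∧ (f k).HasEigenvalue w) :
    ∃ k w, 0 < w.re ∧ (f k).HasEigenvalue w ∧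
      ∀ k' w', (f k').HasEigenvalue w' → w'.re ≤ w.re := by
  obtain ⟨k₀, w₀, hw₀, hk₀⟩ := hunstable
  have hε := half_lt_self hw₀
  set ε := w₀.re / 2
  set modes : Set (Σ _ : ι, ℂ) := {q | (f q.1).HasEigenvalue q.2 ∧ ε < q.2.re}
  have hfin : modes.Finite := by
    have hexcess : {k | ¬∀ w, (f k).HasEigenvalue w → w.re ≤ ε}.Finite := hdecay ε (half_pos hw₀)
    refine (hexcess.biUnion fun k _ =>
      (f k).finite_hasEigenvalue.image (Sigma.mk (β := fun _ => ℂ) k)).subset ?_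
    rintro ⟨k, w⟩ ⟨hw, hre⟩
    exact Set.mem_biUnion (fun h => (h w hw).not_gt hre) ⟨w, hw, rfl⟩
  obtain ⟨⟨k, w⟩, ⟨hk, hw⟩, hmax⟩ :=
    modes.exists_max_image (fun q => q.2.re) hfin ⟨⟨k₀, w₀⟩, hk₀, hε⟩
  refine ⟨k, w, (half_pos hw₀).trans hw, hk, fun k' w' hk' => ?_⟩
  rcases le_or_gt w'.re ε with hle | hlt
  · exact hle.trans hw.le
  · exact hmax ⟨k', w'⟩ ⟨hk', hlt⟩

theorem exists_root_re_pos {b c : ℂ} (h : b.re * (b.re * c.re + b.im * c.im) < c.im ^ 2) :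
    ∃ w : ℂ, 0 < w.re ∧ w ^ 2 + b * w + c = 0 := by
  obtain ⟨r, hr⟩ := IsAlgClosed.exists_pow_nat_eq (b ^ 2 - 4 * c) two_pos
  have hre : r.re ^ 2 - r.im ^ 2 = b.re ^ 2 - b.im ^ 2 - 4 * c.re := by
    simpa [sq] using congrArg Complex.re hr
  have him : r.re * r.im = b.re * b.im - 2 * c.im := by
    have hsq : (r ^ 2).im = (b ^ 2 - 4 * c).im := congrArg Complex.im hr
    have htwice : r.re * r.im + r.re * r.im = b.re * b.im + b.re * b.im - c.im * 4 := by
      simpa [sq, mul_comm] using hsq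
    linarith
  have hlt : b.re ^ 2 < r.re ^ 2 := by
    by_contra! hle
    have hprod : (r.re * r.im) ^ 2 ≤ b.re ^ 2 * (b.im ^ 2 + 4 * c.re) := by
      rw [mul_pow]
      gcongr
      linarith
    rw [him] at hprod
    linarith
  rcases lt_abs.1 ((le_abs_self _).trans_lt (sq_lt_sq.1 hlt)) with hpos | hneg
  · refine ⟨(-b + r) / 2, by simpa using hpos, ?_⟩
    linear_combination hr / 4
  · refine ⟨(-b - r) / 2, ?_, ?_⟩
    · simpa using lt_neg.1 hneg
    · linear_combination hr / 4

section RealForm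

variable {ι : Type*} [Fintype ι]

theorem re_map_ofReal_mulVec (A : Matrix ι ι ℝ) (v : ι → ℂ) :
    (fun i => ((A.map Complex.ofReal *ᵥ v) i).re) = A *ᵥ fun i => (v i).re := by
  ext i
  simp [mulVec, dotProduct]

theorem im_map_ofReal_mulVec (A : Matrix ι ι ℝ) (v : ι → ℂ) :
    (fun i => ((A.map Complex.ofReal *ᵥ v) i).im) = A *ᵥ fun i => (v i).im := by
  ext i
  simp [mulVec, dotProduct]

theorem re_le_of_hasEigenvalue_map_ofReal [DecidableEq ι] {A : Matrix ι ι ℝ} {η : ℝ}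
    (hA : ∀ x, x ⬝ᵥ A *ᵥ x ≤ η * (x ⬝ᵥ x)) {w : ℂ}
    (hw : Module.End.HasEigenvalue (toLin' (A.map Complex.ofReal)) w) : w.re ≤ η := by
  obtain ⟨v, hv⟩ := hw.exists_hasEigenvector
  have heq : A.map Complex.ofReal *ᵥ v = w • v := hv.apply_eq_smul
  set x : ι → ℝ := fun i => (v i).re
  set y : ι → ℝ := fun i => (v i).im
  have hx : A *ᵥ x = w.re • x - w.im • y := by
    rw [← re_map_ofReal_mulVec, heq]; ext i; simp [x, y]
  have hy : A *ᵥ y = w.re • y + w.im • x := by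
    rw [← im_map_ofReal_mulVec, heq]; ext i; simp [x, y]
  have hsum : w.re * (x ⬝ᵥ x + y ⬝ᵥ y) = x ⬝ᵥ A *ᵥ x + y ⬝ᵥ A *ᵥ y := by
    simp only [hx, hy, dotProduct_sub, dotProduct_add, dotProduct_smul, smul_eq_mul,
      dotProduct_comm y x]
    ring
  have hpos : 0 < x ⬝ᵥ x + y ⬝ᵥ y := by
    obtain ⟨i, hi⟩ := Function.ne_iff.1 hv.2
    simp only [dotProduct, ← Finset.sum_add_distrib]
    exact Finset.sum_pos' (fun j _ => Complex.normSq_nonneg (v j))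
      ⟨i, Finset.mem_univ i, Complex.normSq_pos.2 hi⟩
  refine le_of_mul_le_mul_right ?_ hpos
  linarith [hA x, hA y]

theorem two_mul_dotProduct_mulVec_le_of_posSemidef {A : Matrix ι ι ℝ} (hA : A.PosSemidef)
    {δ : ℝ} (hδ : 0 < δ) (x y : ι → ℝ) :
    2 * (x ⬝ᵥ A *ᵥ y) ≤ δ * (x ⬝ᵥ A *ᵥ x) + δ⁻¹ * (y ⬝ᵥ A *ᵥ y) := by
  have hsymm : y ⬝ᵥ A *ᵥ x = x ⬝ᵥ A *ᵥ y := by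
    have hAt : Aᵀ = A := hA.isHermitian
    rw [dotProduct_mulVec, dotProduct_comm, ← mulVec_transpose, hAt]
  have hsq : 0 ≤ δ⁻¹ * ((δ • x - y) ⬝ᵥ A *ᵥ (δ • x - y)) :=
    mul_nonneg (inv_pos.2 hδ).le (hA.dotProduct_mulVec_nonneg _)
  simp only [mulVec_sub, mulVec_smul, dotProduct_sub, sub_dotProduct, dotProduct_smul,
    smul_dotProduct, smul_eq_mul, hsymm] at hsq
  field_simp at hsq ⊢
  linarith

end RealForm

theorem toC_mul {l m n : Type} [Fintype m] (A : Matrix l m ℝ) (B : Matrix m n ℝ) :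
    toC (A * B) = toC A * toC B :=
  Matrix.map_mul (f := Complex.ofRealHom)

theorem toC_smul {m n : Type} (r : ℝ) (A : Matrix m n ℝ) :
    toC (r • A) = (r : ℂ) • toC A := by
  ext i j
  simp [toC]

theorem directSum_mul_blocks_mul_directSum (A B : Matrix (Fin 3) (Fin 3) ℂ)
    (C : Matrix (Fin 2) (Fin 2) ℂ) (A' B' : Matrix (Fin 3) (Fin 3) ℂ)
    (C' : Matrix (Fin 2) (Fin 2) ℂ)
    (A₁₁ A₁₂ : Matrix (Fin 3) (Fin 3) ℂ) (A₁₃ : Matrix (Fin 3) (Fin 2) ℂ)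
    (A₂₁ A₂₂ : Matrix (Fin 3) (Fin 3) ℂ) (A₂₃ : Matrix (Fin 3) (Fin 2) ℂ)
    (A₃₁ A₃₂ : Matrix (Fin 2) (Fin 3) ℂ) (A₃₃ : Matrix (Fin 2) (Fin 2) ℂ) :
    directSum A B C * blocks A₁₁ A₁₂ A₁₃ A₂₁ A₂₂ A₂₃ A₃₁ A₃₂ A₃₃ * directSum A' B' C' =
      blocks (A * A₁₁ * A') (A * A₁₂ * B') (A * A₁₃ * C')
        (B * A₂₁ * A') (B * A₂₂ * B') (B * A₂₃ * C')
        (C * A₃₁ * A') (C * A₃₂ * B') (C * A₃₃ * C') := by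
  simp [directSum, blocks, fromBlocks_multiply, fromCols_mul_fromBlocks, fromBlocks_mul_fromRows,
    fromRows_mul, mul_fromCols]

theorem Ppar_eq_smul_vecMulVec (k : Wave) : Ppar k = (‖k‖ ^ 2)⁻¹ • vecMulVec k k := by
  ext i j
  simp [Ppar, vecMulVec_apply, div_eq_inv_mul]

theorem dotProduct_self_eq_norm_sq (k : Wave) : k.ofLp ⬝ᵥ k.ofLp = ‖k‖ ^ 2 := by
  rw [EuclideanSpace.real_norm_sq_eq]
  simp only [dotProduct, sq]

theorem isStarProjection_Ppar (k : Wave) : IsStarProjection (Ppar k) where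
  isIdempotentElem := by
    have hscalar : (‖k‖ ^ 2)⁻¹ * ((‖k‖ ^ 2)⁻¹ * ‖k‖ ^ 2) = (‖k‖ ^ 2)⁻¹ := by
      simpa [mul_assoc] using mul_self_mul_inv (‖k‖ ^ 2)⁻¹
    rw [IsIdempotentElem, Ppar_eq_smul_vecMulVec, smul_mul_smul_comm, vecMulVec_mul_vecMulVec,
      dotProduct_self_eq_norm_sq, vecMulVec_smul, smul_smul, mul_assoc, hscalar]
  isSelfAdjoint := by
    ext i j
    simp [Ppar, star_apply, mul_comm]

theorem isStarProjection_Pperp (k : Wave) : IsStarProjection (Pperp k) :=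
  (isStarProjection_Ppar k).one_sub

theorem posSemidef_of_isStarProjection {n : Type*} [Fintype n] {P : Matrix n n ℝ}
    (hP : IsStarProjection P) : P.PosSemidef :=
  Matrix.nonneg_iff_posSemidef.1 hP.nonneg

theorem norm_sq_smul_Ppar (k : Wave) : ‖k‖ ^ 2 • Ppar k = vecMulVec k k := by
  by_cases hk : k = 0
  · simp [hk]
  · rw [Ppar_eq_smul_vecMulVec, smul_inv_smul₀ (by simpa using hk)]

theorem cross_mulVec (k : Wave) (v : Fin 3 → ℝ) : cross k *ᵥ v = k.ofLp ⨯₃ v := by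
  ext i
  fin_cases i <;>
    simp [cross, cross_apply, mulVec, dotProduct, Fin.sum_univ_three, neg_add_eq_sub,
      ← sub_eq_add_neg]

theorem cross_mul_cross (k : Wave) : cross k * cross k = -(‖k‖ ^ 2 • Pperp k) := by
  rw [Pperp, smul_sub, norm_sq_smul_Ppar, ext_iff_mulVec]
  intro v
  rw [← mulVec_mulVec, cross_mulVec, cross_mulVec, cross_cross_eq_smul_sub_smul',
    dotProduct_self_eq_norm_sq, neg_mulVec, sub_mulVec, smul_mulVec, one_mulVec, vecMulVec_mulVec,
    neg_sub, op_smul_eq_smul]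

theorem cross_mul_Pperp (k : Wave) : cross k * Pperp k = cross k := by
  have hpar : cross k * Ppar k = 0 := by
    rw [Ppar_eq_smul_vecMulVec, Matrix.mul_smul, mul_vecMulVec, cross_mulVec, cross_self,
      zero_vecMulVec, smul_zero]
  rw [Pperp, mul_sub, mul_one, hpar, sub_zero]

theorem I_smul_cross (k : Wave) : Complex.I • toC (cross k) = (‖k‖ : ℂ) • T k := by
  by_cases hk : k = 0
  · ext i j
    fin_cases i <;> fin_cases j <;> simp [hk, cross, toC]
  · have hnorm : (‖k‖ : ℂ) ≠ 0 := by simpa using hk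
    rw [T, smul_smul, mul_div_cancel₀ _ hnorm]

theorem T_mul_Pperp (k : Wave) : T k * toC (Pperp k) = T k := by
  rw [T, Matrix.smul_mul, ← toC_mul, cross_mul_Pperp]

theorem norm_smul_T_mul_T (k : Wave) : (‖k‖ : ℂ) • (T k * T k) = (‖k‖ : ℂ) • toC (Pperp k) := by
  by_cases hk : k = 0
  · simp [hk]
  · have hnorm : (‖k‖ : ℂ) ≠ 0 := by simpa using hk
    have hscalar : Complex.I / (‖k‖ : ℂ) * (Complex.I / ‖k‖) * ((-‖k‖ ^ 2 : ℝ) : ℂ) = 1 := by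
      push_cast
      field_simp
      simp
    rw [T, smul_mul_smul_comm, ← toC_mul, cross_mul_cross, ← neg_smul, toC_smul,
      smul_smul (_ * _), hscalar, one_smul]

theorem T_mul_smul_Pperp_mul_T (c : ℝ) (k : Wave) :
    T k * toC (-(c * ‖k‖ ^ 2) • Pperp k) * T k = toC (-(c * ‖k‖ ^ 2) • Pperp k) := by
  simp only [toC_smul, Matrix.mul_smul, Matrix.smul_mul, T_mul_Pperp]
  have hscaled := congrArg ((-(c * ‖k‖) : ℂ) • ·) (norm_smul_T_mul_T k)
  simp only [smul_smul] at hscaled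
  push_cast
  convert hscaled using 2 <;> ring

theorem T_mul_I_smul_cross (c : ℝ) (k : Wave) :
    T k * ((Complex.I * c) • toC (cross k)) = toC ((c * ‖k‖) • Pperp k) := by
  rw [mul_comm, ← smul_smul, I_smul_cross, Matrix.mul_smul, Matrix.mul_smul, norm_smul_T_mul_T,
    smul_smul, toC_smul, Complex.ofReal_mul]

theorem I_smul_cross_mul_T (c : ℝ) (k : Wave) :
    ((Complex.I * c) • toC (cross k)) * T k = toC ((c * ‖k‖) • Pperp k) := by
  rw [mul_comm, ← smul_smul, I_smul_cross, Matrix.smul_mul, Matrix.smul_mul, norm_smul_T_mul_T,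
    smul_smul, toC_smul, Complex.ofReal_mul]

/-- The inclusion of the horizontal plane `ℝ²` into `ℝ³`, through which `R₂₃`, `R₃₂` and `R₃₃` are
obtained from the quarter turn `R₂₂`. -/
noncomputable def planeIncl : Matrix (Fin 3) (Fin 2) ℝ := !![1, 0; 0, 1; 0, 0]

theorem R22_mul_R22 : R22 * R22 = -1 := by
  ext i j
  fin_cases i <;> fin_cases j <;> simp [R22, Matrix.mul_apply]

theorem planeIncl_mul_R22 : planeIncl * R22 = R32 := by
  ext i j
  fin_cases i <;> fin_cases j <;> simp [planeIncl, R22, R32, Matrix.mul_apply]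

theorem R22_mul_planeIncl_transpose : R22 * planeInclᵀ = R23 := by
  ext i j
  fin_cases i <;> fin_cases j <;> simp [planeIncl, R22, R23, Matrix.mul_apply]

theorem R32_mul_planeIncl_transpose : R32 * planeInclᵀ = R33 := by
  ext i j
  fin_cases i <;> fin_cases j <;> simp [planeIncl, R32, R33, Matrix.mul_apply]

theorem rpow_neg_half {t : ℝ} (ht : 0 ≤ t) : t ^ (-1 / 2 : ℝ) = (√t)⁻¹ := by
  rw [Real.sqrt_eq_rpow, neg_div, Real.rpow_neg ht]

namespace Params

variable {p : Params}

theorem JeqPow_mul_planeIncl (p : Params) (r : ℝ) :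
    p.JeqPow r * planeIncl = p.lam ^ r • planeIncl := by
  ext i j
  rw [JeqPow, diagonal_mul]
  fin_cases i <;> fin_cases j <;> simp [planeIncl]

theorem JeqPow_transpose (p : Params) (r : ℝ) : (p.JeqPow r)ᵀ = p.JeqPow r :=
  diagonal_transpose _

theorem planeIncl_transpose_mul_JeqPow (p : Params) (r : ℝ) :
    planeInclᵀ * p.JeqPow r = p.lam ^ r • planeInclᵀ := by
  rw [← p.JeqPow_transpose, ← transpose_mul, JeqPow_mul_planeIncl, transpose_smul]

theorem JeqPow_mul_JeqPow (hlam : 0 < p.lam) (hν : 0 < p.ν) (a b : ℝ) :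
    p.JeqPow a * p.JeqPow b = p.JeqPow (a + b) := by
  rw [JeqPow, JeqPow, JeqPow, diagonal_mul_diagonal]
  congr 1
  ext i
  fin_cases i <;> simp [Real.rpow_add, hlam, hν]

theorem JeqPow_half_mul_JeqPow_neg_one (hlam : 0 < p.lam) (hν : 0 < p.ν) :
    p.JeqPow (1 / 2) * p.JeqPow (-1) = p.JeqPow (-1 / 2) := by
  rw [JeqPow_mul_JeqPow hlam hν]
  norm_num

theorem d_ne_zero (hκ : p.κ ≠ 0) (hτ : p.τ ≠ 0) : p.d ≠ 0 :=
  div_ne_zero hτ (mul_ne_zero two_ne_zero hκ)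

theorem s_ne_zero (hd : p.d ≠ 0) (hνlam : p.ν < p.lam) : p.s ≠ 0 :=
  mul_ne_zero (div_ne_zero (neg_ne_zero.2 one_ne_zero) (Real.sqrt_pos.2 (sub_pos.2 hνlam)).ne') hd

theorem one_sub_ν_div_lam_pos (hlam : 0 < p.lam) (hνlam : p.ν < p.lam) : 0 < 1 - p.ν / p.lam :=
  sub_pos.2 ((div_lt_one hlam).2 hνlam)

/-- The strength of the coupling between the horizontal angular velocity and the microinertia in
`M p k`. -/
noncomputable def coupling (p : Params) : ℝ := p.d * √(1 - p.ν / p.lam)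

theorem coupling_eq (hlam : 0 < p.lam) : p.coupling = p.d * √(p.lam - p.ν) / √p.lam := by
  rw [coupling, one_sub_div hlam.ne', Real.sqrt_div' _ hlam.le, mul_div_assoc]

theorem coupling_ne_zero (hd : p.d ≠ 0) (hlam : 0 < p.lam) (hνlam : p.ν < p.lam) :
    p.coupling ≠ 0 :=
  mul_ne_zero hd (Real.sqrt_pos.2 (one_sub_ν_div_lam_pos hlam hνlam)).ne'

theorem coupling_sq (hlam : 0 < p.lam) (hνlam : p.ν < p.lam) :
    p.coupling ^ 2 = p.d ^ 2 * (1 - p.ν / p.lam) := by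
  rw [coupling, mul_pow, Real.sq_sqrt (one_sub_ν_div_lam_pos hlam hνlam).le]

/-- The resistance of the fluid to microrotation at wavenumber `k`: friction against the velocity
`2κ`, and angular viscosities `α̃` along `k` and `γ̃` across it. -/
noncomputable def rotResistance (p : Params) (k : Wave) : Matrix (Fin 3) (Fin 3) ℝ :=
  (2 * p.κ) • 1 + (p.αt * ‖k‖ ^ 2) • Ppar k + (p.γt * ‖k‖ ^ 2) • Pperp k

/-- The real matrix of which `M p k` is the complexification. -/
noncomputable def realSymbol (p : Params) (k : Wave) : Matrix Idx Idx ℝ :=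
  fromBlocks (-((p.μ + p.κ / 2) * ‖k‖ ^ 2) • Pperp k)
    (fromCols ((p.κ * ‖k‖) • (Pperp k * p.JeqPow (-1 / 2))) 0)
    (fromRows ((p.κ * ‖k‖) • (p.JeqPow (-1 / 2) * Pperp k)) 0)
    (fromBlocks
      (-(p.JeqPow (-1 / 2) * p.rotResistance k * p.JeqPow (-1 / 2))
        - ((1 - p.ν / p.lam) * p.d) • R33)
      (p.coupling • planeIncl) (p.coupling • planeInclᵀ) (p.d • R22))

theorem JeqPow_mul_rotationBlock_mul_JeqPow (hlam : 0 < p.lam) (hν : 0 < p.ν) (k : Wave) :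
    p.JeqPow (1 / 2) * (-(2 * p.κ) • p.JeqPow (-1)
      - (p.αt * ‖k‖ ^ 2) • (p.JeqPow (-1) * Ppar k)
      - (p.γt * ‖k‖ ^ 2) • (p.JeqPow (-1) * Pperp k)
      - ((1 - p.ν / p.lam) * p.d) • R33) * p.JeqPow (-1 / 2) =
    -(p.JeqPow (-1 / 2) * p.rotResistance k * p.JeqPow (-1 / 2))
      - ((1 - p.ν / p.lam) * p.d) • R33 := by
  have hR : p.JeqPow (1 / 2) * R33 * p.JeqPow (-1 / 2) = R33 := by
    rw [← R32_mul_planeIncl_transpose, ← planeIncl_mul_R22, ← Matrix.mul_assoc,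
      ← Matrix.mul_assoc, JeqPow_mul_planeIncl, Matrix.mul_assoc, planeIncl_transpose_mul_JeqPow,
      Matrix.mul_smul, Matrix.smul_mul, Matrix.smul_mul, smul_smul, ← Real.rpow_add hlam]
    norm_num
  rw [mul_sub, sub_mul, Matrix.mul_smul, Matrix.smul_mul, hR, rotResistance]
  congr 1
  simp only [mul_sub, mul_add, Matrix.mul_smul, ← Matrix.mul_assoc,
    JeqPow_half_mul_JeqPow_neg_one hlam hν, mul_one, neg_smul, sub_mul, add_mul, mul_neg, neg_mul]
  abel

theorem JeqPow_mul_smul_R32_mul_smul_R22 (hlam : 0 < p.lam) :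
    p.JeqPow (1 / 2) * (-(1 / p.lam * p.d ^ 2) • R32) * ((-p.s⁻¹) • R22) =
      p.coupling • planeIncl := by
  have hcoupling : √p.lam * (1 / p.lam * p.d ^ 2) * -p.s⁻¹ = p.coupling := by
    rw [coupling_eq hlam, s]
    field_simp
    rw [Real.sq_sqrt hlam.le]
  have hincl : p.JeqPow (1 / 2) * R32 * R22 = -(√p.lam • planeIncl) := by
    rw [← planeIncl_mul_R22, ← Matrix.mul_assoc, JeqPow_mul_planeIncl, Matrix.mul_assoc,
      R22_mul_R22, Matrix.mul_neg, Matrix.mul_one, ← Real.sqrt_eq_rpow]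
  rw [← hcoupling, Matrix.mul_smul, Matrix.mul_smul, Matrix.smul_mul, hincl]
  module

theorem smul_R22_mul_smul_R23_mul_JeqPow (hlam : 0 < p.lam) (hνlam : p.ν < p.lam) :
    (p.s • R22) * ((p.lam - p.ν) • R23) * p.JeqPow (-1 / 2) = p.coupling • planeInclᵀ := by
  have hsqrt : √(p.lam - p.ν) ≠ 0 := (Real.sqrt_pos.2 (sub_pos.2 hνlam)).ne'
  have hcoupling : -p.s * (p.lam - p.ν) * (√p.lam)⁻¹ = p.coupling := by
    rw [coupling_eq hlam, s, ← Real.sq_sqrt (sub_pos.2 hνlam).le]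
    field_simp
    simp
  have hincl : R22 * R23 * p.JeqPow (-1 / 2) = -((√p.lam)⁻¹ • planeInclᵀ) := by
    rw [← R22_mul_planeIncl_transpose, ← Matrix.mul_assoc, R22_mul_R22, Matrix.mul_assoc,
      planeIncl_transpose_mul_JeqPow, Matrix.neg_mul, Matrix.one_mul, rpow_neg_half hlam.le]
  rw [← hcoupling, Matrix.smul_mul, Matrix.mul_smul, Matrix.smul_mul, Matrix.smul_mul, hincl]
  module

theorem smul_R22_mul_smul_R22_mul_smul_R22 (hs : p.s ≠ 0) :
    (p.s • R22) * (p.d • R22) * ((-p.s⁻¹) • R22) = p.d • R22 := by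
  simp only [Matrix.smul_mul, Matrix.mul_smul, R22_mul_R22, smul_smul, neg_mul, one_mul]
  match_scalars
  field_simp

theorem M_eq_toC_realSymbol (hd : p.d ≠ 0) (hν : 0 < p.ν) (hνlam : p.ν < p.lam) (k : Wave) :
    M p k = toC (p.realSymbol k) := by
  have hlam := hν.trans hνlam
  have hrotation : toC (p.JeqPow (1 / 2)) *
      (toC (p.JeqPow (-1)) * ((Complex.I * p.κ) • toC (cross k)) * toC (Pperp k)) * T k =
      toC ((p.κ * ‖k‖) • (p.JeqPow (-1 / 2) * Pperp k)) := by
    rw [Matrix.mul_assoc (toC (p.JeqPow (-1))), Matrix.smul_mul, ← toC_mul, cross_mul_Pperp,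
      ← Matrix.mul_assoc, ← toC_mul, JeqPow_half_mul_JeqPow_neg_one hlam hν, Matrix.mul_assoc,
      I_smul_cross_mul_T, ← toC_mul, Matrix.mul_smul]
  have hvelocity : toC ((p.κ * ‖k‖) • Pperp k) * toC (p.JeqPow (-1 / 2)) =
      toC ((p.κ * ‖k‖) • (Pperp k * p.JeqPow (-1 / 2))) := by
    rw [← toC_mul, Matrix.smul_mul]
  rw [M, Q, Qbar, Bhat, directSum_mul_blocks_mul_directSum, T_mul_smul_Pperp_mul_T,
    T_mul_I_smul_cross, hrotation, hvelocity]
  simp only [← toC_mul, JeqPow_mul_rotationBlock_mul_JeqPow hlam hν,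
    JeqPow_mul_smul_R32_mul_smul_R22 hlam, smul_R22_mul_smul_R23_mul_JeqPow hlam hνlam,
    smul_R22_mul_smul_R22_mul_smul_R22 (s_ne_zero hd hνlam), Matrix.mul_zero, Matrix.zero_mul]
  ext (i | i | i) (j | j | j) <;> simp [blocks, toC, realSymbol]

end Params

theorem dotProduct_mulVec_self_of_transpose_eq_neg {n : Type*} [Fintype n] {A : Matrix n n ℝ}
    (hA : Aᵀ = -A) (x : n → ℝ) : x ⬝ᵥ A *ᵥ x = 0 := by
  have hskew : x ⬝ᵥ A *ᵥ x = -(x ⬝ᵥ A *ᵥ x) := by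
    conv_lhs => rw [dotProduct_mulVec, ← mulVec_transpose, hA, neg_mulVec, neg_dotProduct,
      dotProduct_comm]
  linarith

theorem R22_transpose : R22ᵀ = -R22 := by
  ext i j
  fin_cases i <;> fin_cases j <;> simp [R22]

theorem R33_transpose : R33ᵀ = -R33 := by
  ext i j
  fin_cases i <;> fin_cases j <;> simp [R33]

theorem dotProduct_mulVec_le_of_isStarProjection {n : Type*} [Fintype n]
    {P : Matrix n n ℝ} (hP : IsStarProjection P) (x : n → ℝ) : x ⬝ᵥ P *ᵥ x ≤ x ⬝ᵥ x := by
  classical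
  have hcompl : 0 ≤ x ⬝ᵥ (1 - P) *ᵥ x :=
    (posSemidef_of_isStarProjection hP.one_sub).dotProduct_mulVec_nonneg x
  rwa [sub_mulVec, one_mulVec, dotProduct_sub, sub_nonneg] at hcompl

theorem planeIncl_transpose_mulVec_dotProduct_self_le (o : Fin 3 → ℝ) :
    (planeInclᵀ *ᵥ o) ⬝ᵥ (planeInclᵀ *ᵥ o) ≤ o ⬝ᵥ o := by
  simpa [planeIncl, dotProduct, mulVec, Fin.sum_univ_two, Fin.sum_univ_three] using
    mul_self_nonneg (o 2)

namespace Params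

variable {p : Params}

theorem JeqPow_mulVec_dotProduct (r : ℝ) (x y : Fin 3 → ℝ) :
    (p.JeqPow r *ᵥ x) ⬝ᵥ y = x ⬝ᵥ p.JeqPow r *ᵥ y := by
  rw [dotProduct_mulVec, ← mulVec_transpose, JeqPow_transpose]

theorem dotProduct_realSymbol_mulVec (p : Params) (k : Wave) (u o : Fin 3 → ℝ) (a : Fin 2 → ℝ) :
    Sum.elim u (Sum.elim o a) ⬝ᵥ p.realSymbol k *ᵥ Sum.elim u (Sum.elim o a) =
      -((p.μ + p.κ / 2) * ‖k‖ ^ 2) * (u ⬝ᵥ Pperp k *ᵥ u)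
        + 2 * (p.κ * ‖k‖) * (u ⬝ᵥ Pperp k *ᵥ p.JeqPow (-1 / 2) *ᵥ o)
        - (p.JeqPow (-1 / 2) *ᵥ o) ⬝ᵥ p.rotResistance k *ᵥ p.JeqPow (-1 / 2) *ᵥ o
        + 2 * p.coupling * (a ⬝ᵥ planeInclᵀ *ᵥ o) := by
  have hPerp : o ⬝ᵥ p.JeqPow (-1 / 2) *ᵥ Pperp k *ᵥ u =
      u ⬝ᵥ Pperp k *ᵥ p.JeqPow (-1 / 2) *ᵥ o := by
    have hsymm : (Pperp k)ᵀ = Pperp k := (isStarProjection_Pperp k).isSelfAdjoint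
    rw [← JeqPow_mulVec_dotProduct, dotProduct_comm, dotProduct_mulVec u, ← mulVec_transpose, hsymm]
  have hplane : o ⬝ᵥ planeIncl *ᵥ a = a ⬝ᵥ planeInclᵀ *ᵥ o := by
    rw [dotProduct_mulVec, ← mulVec_transpose, dotProduct_comm]
  simp only [realSymbol, fromBlocks_mulVec, fromCols_mulVec_sumElim, fromRows_mulVec,
    sumElim_dotProduct_sumElim, Sum.elim_comp_inl, Sum.elim_comp_inr, zero_mulVec, add_zero,
    smul_mulVec, sub_mulVec, neg_mulVec, ← mulVec_mulVec, dotProduct_add, dotProduct_sub,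
    dotProduct_neg, dotProduct_smul, dotProduct_zero, smul_eq_mul,
    dotProduct_mulVec_self_of_transpose_eq_neg R22_transpose,
    dotProduct_mulVec_self_of_transpose_eq_neg R33_transpose, hPerp, hplane,
    JeqPow_mulVec_dotProduct]
  ring

/-- A lower bound for the damping of the rescaled angular velocity `J_eq^{-1/2} ω` at wavenumber `k`
that remains once the velocity has been eliminated. -/
noncomputable def rotDamping (p : Params) (k : Wave) : ℝ :=
  min p.αt p.γt * ‖k‖ ^ 2 + 2 * p.κ - p.κ ^ 2 / (p.μ + p.κ / 2)

theorem le_dotProduct_rotResistance_mulVec (p : Params) (k : Wave) (z : Fin 3 → ℝ) :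
    (2 * p.κ + min p.αt p.γt * ‖k‖ ^ 2) * (z ⬝ᵥ z) ≤ z ⬝ᵥ p.rotResistance k *ᵥ z := by
  have hpar : 0 ≤ z ⬝ᵥ Ppar k *ᵥ z :=
    (posSemidef_of_isStarProjection (isStarProjection_Ppar k)).dotProduct_mulVec_nonneg z
  have hperp : 0 ≤ z ⬝ᵥ Pperp k *ᵥ z :=
    (posSemidef_of_isStarProjection (isStarProjection_Pperp k)).dotProduct_mulVec_nonneg z
  have hsum : z ⬝ᵥ z = z ⬝ᵥ Ppar k *ᵥ z + z ⬝ᵥ Pperp k *ᵥ z := by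
    rw [← dotProduct_add, ← add_mulVec, Pperp, add_sub_cancel, one_mulVec]
  have hα := mul_le_mul_of_nonneg_right (min_le_left p.αt p.γt)
    (mul_nonneg (sq_nonneg ‖k‖) hpar)
  have hγ := mul_le_mul_of_nonneg_right (min_le_right p.αt p.γt)
    (mul_nonneg (sq_nonneg ‖k‖) hperp)
  simp only [rotResistance, add_mulVec, smul_mulVec, one_mulVec, dotProduct_add, dotProduct_smul,
    smul_eq_mul]
  rw [hsum]
  linarith

theorem two_mul_dotProduct_Pperp_mulVec_le {N : ℝ} (hN : 0 < N) (κ : ℝ) (k : Wave)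
    (u z : Fin 3 → ℝ) :
    2 * (κ * ‖k‖) * (u ⬝ᵥ Pperp k *ᵥ z) ≤
      N * ‖k‖ ^ 2 * (u ⬝ᵥ Pperp k *ᵥ u) + κ ^ 2 / N * (z ⬝ᵥ z) := by
  have hyoung := two_mul_dotProduct_mulVec_le_of_posSemidef
    (posSemidef_of_isStarProjection (isStarProjection_Pperp k)) hN (‖k‖ • u) (κ • z)
  have hproj := mul_le_mul_of_nonneg_left
    (dotProduct_mulVec_le_of_isStarProjection (isStarProjection_Pperp k) z)
    (div_nonneg (sq_nonneg κ) hN.le)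
  simp only [mulVec_smul, dotProduct_smul, smul_dotProduct, smul_eq_mul] at hyoung
  linear_combination hyoung + hproj

theorem two_mul_dotProduct_planeIncl_transpose_mulVec_le {η : ℝ} (hη : 0 < η) (hlam : 0 < p.lam)
    (c : ℝ) (a : Fin 2 → ℝ) (o : Fin 3 → ℝ) :
    2 * c * (a ⬝ᵥ planeInclᵀ *ᵥ o) ≤ η * (a ⬝ᵥ a)
      + η⁻¹ * (c ^ 2 * p.lam) * ((p.JeqPow (-1 / 2) *ᵥ o) ⬝ᵥ (p.JeqPow (-1 / 2) *ᵥ o)) := by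
  set z := p.JeqPow (-1 / 2) *ᵥ o with hz
  have hplane : planeInclᵀ *ᵥ o = √p.lam • planeInclᵀ *ᵥ z := by
    rw [hz, mulVec_mulVec, planeIncl_transpose_mul_JeqPow, rpow_neg_half hlam.le, smul_mulVec,
      smul_inv_smul₀ (Real.sqrt_pos.2 hlam).ne']
  have hle : (planeInclᵀ *ᵥ o) ⬝ᵥ (planeInclᵀ *ᵥ o) ≤ p.lam * (z ⬝ᵥ z) := by
    rw [hplane, smul_dotProduct, dotProduct_smul, smul_smul, Real.mul_self_sqrt hlam.le]
    exact mul_le_mul_of_nonneg_left (planeIncl_transpose_mulVec_dotProduct_self_le z) hlam.le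
  have hyoung :=
    two_mul_dotProduct_mulVec_le_of_posSemidef PosSemidef.one hη a (c • planeInclᵀ *ᵥ o)
  have hscaled := mul_le_mul_of_nonneg_left hle (mul_nonneg (inv_pos.2 hη).le (sq_nonneg c))
  simp only [one_mulVec, dotProduct_smul, smul_dotProduct, smul_eq_mul] at hyoung
  linarith

theorem dotProduct_realSymbol_mulVec_le {η : ℝ} (hμκ : 0 < p.μ + p.κ / 2) (hlam : 0 < p.lam)
    (hη : 0 < η) (k : Wave) (hdamping : p.coupling ^ 2 * p.lam ≤ η * p.rotDamping k)
    (x : Idx → ℝ) : x ⬝ᵥ p.realSymbol k *ᵥ x ≤ η * (x ⬝ᵥ x) := by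
  obtain ⟨u, y, rfl⟩ : ∃ u y, x = Sum.elim u y := ⟨_, _, (Sum.elim_comp_inl_inr x).symm⟩
  obtain ⟨o, a, rfl⟩ : ∃ o a, y = Sum.elim o a := ⟨_, _, (Sum.elim_comp_inl_inr y).symm⟩
  rw [dotProduct_realSymbol_mulVec, sumElim_dotProduct_sumElim, sumElim_dotProduct_sumElim]
  have hinertia := two_mul_dotProduct_planeIncl_transpose_mulVec_le hη hlam p.coupling a o
  set z := p.JeqPow (-1 / 2) *ᵥ o
  have hvelocity := two_mul_dotProduct_Pperp_mulVec_le hμκ p.κ k u z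
  have hresistance := p.le_dotProduct_rotResistance_mulVec k z
  have habsorb : η⁻¹ * (p.coupling ^ 2 * p.lam) * (z ⬝ᵥ z) ≤ p.rotDamping k * (z ⬝ᵥ z) :=
    mul_le_mul_of_nonneg_right ((inv_mul_le_iff₀ hη).2 hdamping) (dotProduct_self_star_nonneg z)
  have hrest : 0 ≤ η * (u ⬝ᵥ u + o ⬝ᵥ o) :=
    mul_nonneg hη.le (add_nonneg (dotProduct_self_star_nonneg u) (dotProduct_self_star_nonneg o))
  rw [rotDamping] at habsorb
  linarith

theorem re_le_of_isEigenvalue {η : ℝ} (hμκ : 0 < p.μ + p.κ / 2) (hd : p.d ≠ 0) (hν : 0 < p.ν)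
    (hνlam : p.ν < p.lam) (hη : 0 < η) {k : Wave}
    (hdamping : p.coupling ^ 2 * p.lam ≤ η * p.rotDamping k) {w : ℂ}
    (hw : IsEigenvalue (M p k) w) : w.re ≤ η := by
  rw [M_eq_toC_realSymbol hd hν hνlam] at hw
  exact re_le_of_hasEigenvalue_map_ofReal
    (dotProduct_realSymbol_mulVec_le hμκ (hν.trans hνlam) hη k hdamping) hw

end Params

theorem tendsto_norm_latt_cofinite_atTop : Tendsto (fun k => ‖latt k‖) cofinite atTop := by
  have hint : Tendsto (fun k : Fin 3 → ℤ => ‖k‖) cofinite atTop := by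
    rw [← cocompact_eq_cofinite]
    exact tendsto_norm_cocompact_atTop
  refine tendsto_atTop_mono (fun k => ?_) hint
  refine (pi_norm_le_iff_of_nonneg (norm_nonneg _)).2 fun i => ?_
  exact (Int.norm_cast_real (k i)).symm.trans_le (PiLp.norm_apply_le (latt k) i)

theorem latt_zero : latt 0 = 0 := by
  ext i
  simp [latt]

namespace Params

variable {p : Params}

theorem tendsto_rotDamping_latt (hα : 0 < p.αt) (hγ : 0 < p.γt) :
    Tendsto (fun k => p.rotDamping (latt k)) cofinite atTop := by
  have hsq := (tendsto_pow_atTop two_ne_zero).comp tendsto_norm_latt_cofinite_atTop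
  have hmin := hsq.const_mul_atTop (lt_min hα hγ)
  exact tendsto_atTop_add_const_right _ (-(p.κ ^ 2 / (p.μ + p.κ / 2)))
    (tendsto_atTop_add_const_right _ (2 * p.κ) hmin)

theorem eventually_re_le_of_isEigenvalue (hμκ : 0 < p.μ + p.κ / 2) (hd : p.d ≠ 0)
    (hα : 0 < p.αt) (hγ : 0 < p.γt) (hν : 0 < p.ν) (hνlam : p.ν < p.lam) {ε : ℝ} (hε : 0 < ε) :
    ∀ᶠ k in cofinite, ∀ w, IsEigenvalue (M p (latt k)) w → w.re ≤ ε := by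
  filter_upwards [(tendsto_rotDamping_latt hα hγ).eventually_ge_atTop
    (p.coupling ^ 2 * p.lam / ε)] with k hk w hw
  exact re_le_of_isEigenvalue hμκ hd hν hνlam hε ((div_le_iff₀' hε).1 hk) hw

theorem isEigenvalue_M_zero (hd : p.d ≠ 0) (hν : 0 < p.ν) (hνlam : p.ν < p.lam) {w : ℂ}
    (hw : (w + (2 * p.κ / p.lam : ℝ) + Complex.I * ((1 - p.ν / p.lam) * p.d : ℝ)) *
      (w - Complex.I * p.d) = (p.coupling ^ 2 : ℝ)) :
    IsEigenvalue (M p 0) w := by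
  have hlam := hν.trans hνlam
  rw [M_eq_toC_realSymbol hd hν hνlam]
  set q : ℝ := p.lam ^ (-1 / 2 : ℝ) with hqdef
  have hq : (q : ℂ) ^ 2 = (p.lam : ℂ)⁻¹ := by
    rw [hqdef, rpow_neg_half hlam.le, ← Complex.ofReal_pow, inv_pow, Real.sq_sqrt hlam.le,
      Complex.ofReal_inv]
  set y := w - Complex.I * p.d with hy
  -- `ζ = (1, -i)` is an eigenvector of `R₂₂`, and the modes `(0, (y ζ, 0), c ζ)` are invariant.
  refine Module.End.hasEigenvalue_of_hasEigenvector
    (x := Sum.elim 0 (Sum.elim ![y, -Complex.I * y, 0]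
      ![(p.coupling : ℂ), -Complex.I * p.coupling])) ⟨Module.End.mem_eigenspace_iff.2 ?_, ?_⟩
  · push_cast at hw
    ext (i | i | i) <;> fin_cases i <;>
      simp [realSymbol, rotResistance, toC, JeqPow, mulVec, dotProduct,
        Fin.sum_univ_three, Pperp, Ppar, planeIncl, R33, R22, ← hqdef]
    · linear_combination -hw - 2 * p.κ * y * hq
    · linear_combination Complex.I * (hw + 2 * p.κ * y * hq)
        - p.d * (1 - p.ν / p.lam) * y * Complex.I_sq
    · linear_combination p.coupling * hy
    · linear_combination -Complex.I * p.coupling * hy + p.coupling * p.d * Complex.I_sq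
  · intro hzero
    have hentry := congrFun hzero (Sum.inr (Sum.inr 0))
    simp [coupling_ne_zero hd hlam hνlam] at hentry

theorem exists_isEigenvalue_M_zero_re_pos (hκ : p.κ ≠ 0) (hτ : p.τ ≠ 0) (hν : 0 < p.ν)
    (hνlam : p.ν < p.lam) : ∃ w, 0 < w.re ∧ IsEigenvalue (M p 0) w := by
  have hlam := hν.trans hνlam
  have hd := d_ne_zero hκ hτ
  set a := 2 * p.κ / p.lam with ha
  have hasq : 0 < a ^ 2 := sq_pos_of_ne_zero (div_ne_zero (mul_ne_zero two_ne_zero hκ) hlam.ne')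
  set θ := 1 - p.ν / p.lam with hθ
  have hθ0 : 0 < θ := one_sub_ν_div_lam_pos hlam hνlam
  obtain ⟨w, hre, hroot⟩ := exists_root_re_pos (b := ⟨a, -((1 - θ) * p.d)⟩) (c := ⟨0, -(a * p.d)⟩)
    (by
      have hpos : 0 < θ * a ^ 2 * p.d ^ 2 := mul_pos (mul_pos hθ0 hasq) (sq_pos_of_ne_zero hd)
      linarith)
  refine ⟨w, hre, isEigenvalue_M_zero hd hν hνlam ?_⟩
  rw [coupling_sq hlam hνlam, ← ha, ← hθ]
  simp only [Complex.mk_eq_add_mul_I] at hroot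
  push_cast at hroot ⊢
  linear_combination hroot - θ * p.d ^ 2 * Complex.I_sq

end Params

end Micropolar

theorem mainTheorem5_general (p : Micropolar.Params) (hμκ : 0 < p.μ + p.κ / 2) (hκ : p.κ ≠ 0)
    (hα : 0 < p.αt) (hγ : 0 < p.γt) (hτ : p.τ ≠ 0) (hν : 0 < p.ν) (hνlam : p.ν < p.lam) :
    ∃ (kstar : Fin 3 → ℤ) (wstar : ℂ), 0 < wstar.re ∧
      Micropolar.IsEigenvalue (Micropolar.M p (Micropolar.latt kstar)) wstar ∧
      ∀ (k : Fin 3 → ℤ) (w : ℂ),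
        Micropolar.IsEigenvalue (Micropolar.M p (Micropolar.latt k)) w → w.re ≤ wstar.re := by
  have hd := Micropolar.Params.d_ne_zero hκ hτ
  obtain ⟨w, hre, hw⟩ := Micropolar.Params.exists_isEigenvalue_M_zero_re_pos hκ hτ hν hνlam
  rw [← Micropolar.latt_zero] at hw
  exact Micropolar.exists_max_re_hasEigenvalue
    (fun k => Matrix.toLin' (Micropolar.M p (Micropolar.latt k)))
    (fun _ => Micropolar.Params.eventually_re_le_of_isEigenvalue hμκ hd hα hγ hν hνlam)
    ⟨0, w, hre, hw⟩

theorem mainTheorem5 (p : Micropolar.Params) (hp : p.Oblong) :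
    ∃ (kstar : Fin 3 → ℤ) (wstar : ℂ), 0 < wstar.re ∧
      Micropolar.IsEigenvalue (Micropolar.M p (Micropolar.latt kstar)) wstar ∧
      ∀ (k : Fin 3 → ℤ) (w : ℂ),
        Micropolar.IsEigenvalue (Micropolar.M p (Micropolar.latt k)) w → w.re ≤ wstar.re :=
  mainTheorem5_general p (add_pos hp.μ_pos (half_pos hp.κ_pos)) hp.κ_pos.ne' hp.αt_pos hp.γt_pos
    hp.τ_pos.ne' hp.ν_pos hp.ν_lt_lam
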